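/- Let $d\ge 1$, let $\mathbb X\subseteq\mathbb R^d$ be a non-empty, unbounded Borel set, and let $X=(X_n)_{n\ge 0}$ be a discrete-time, time-homogeneous Markov process on $\mathbb X$ started at a fixed point $X_0=x_0\in\mathbb X$. Let $\|\cdot\|$ be the Euclidean norm and $\|\cdot\|_{\rm op}$ the corresponding operator norm on matrices. Let $\mathbb E_x$ denote expectation for the process started from $x\in\mathbb X$, put $\Delta=X_1-X_0$ and, for $x\in\mathbb X$, $M(x)=\mathbb E_x[\Delta\Delta^{\top}]$. For $x\ne 0$ write $\hat x=x/\|x\|$, and let $\hat 0=e_1$. Suppose that: (A0) $\sup_{x\in\mathbb X}\mathbb E_x[\|\Delta\|^p]<\infty$ for some $p>2$; (A1) $\mathbb E_x[\Delta]=0$ for all $x\in\mathbb X$; (A2) there is $v>0$ with $\operatorname{tr}M(x)=\mathbb E_x[\|\Delta\|^2]\ge v$ for all $x\in\mathbb X$; (A3) there is a function $\sigma^2$ from the unit sphere $\mathbb S^{d-1}$ to the (symmetric) positive-definite $d\times d$ matrices such that $\varepsilon(r):=\sup_{x\in\mathbb X,\ \|x\|\ge r}\|M(x)-\sigma^2(\hat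 x)\|_{\rm op}\to 0$ as $r\to\infty$; (A4) there are constants $0<U<V<\infty$ such that $u^{\top}\sigma^2(u)\,u=U$ and $\operatorname{tr}\sigma^2(u)=V$ for all $u\in\mathbb S^{d-1}$. Suppose moreover that one of the following holds: (i) $2U<V$; (ii) $2U>V$; (iii) $2U=V$ and $\varepsilon(r)=O(r^{-\delta_0})$ as $r\to\infty$ for some $\delta_0>0$. Then $X$ is null: for every bounded $A\subset\mathbb R^d$, $$\lim_{n\to\infty}\frac1n\sum_{k=0}^{n-1}\mathbf 1\{X_k\in A\}=0,\quad\text{almost surely and in } L^q \text{ for every } q\in[1,\infty).$$ -/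

import Mathlib

open MeasureTheory ProbabilityTheory Filter Topology
open scoped ENNReal Matrix

noncomputable section

namespace NonhomWalk

/-- Euclidean space `ℝ^d` with the Euclidean norm. -/
abbrev E (d : ℕ) : Type := EuclideanSpace ℝ (Fin d)

/-- The unit sphere of `ℝ^d`. -/
abbrev Sph (d : ℕ) : Type := Metric.sphere (0 : E d) 1

/-- The direction `x / ‖x‖` of a vector `x ≠ 0`; the direction of `0` is the first standard
basis vector by convention. -/
def hat {d : ℕ} [NeZero d] (x : E d) : Sph d :=
  if hx : x = 0 then ⟨EuclideanSpace.single 0 1, by simp⟩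
  else ⟨‖x‖⁻¹ • x, by simp [norm_smul, hx]⟩

section Chain

variable {S Ω : Type*} [MeasurableSpace S] [MeasurableSpace Ω]

/-- The `σ`-algebra generated by `X_0, …, X_n`. -/
abbrev history (X : ℕ → Ω → S) (n : ℕ) : MeasurableSpace Ω :=
  ⨆ k : ℕ, ⨆ _ : k ≤ n, MeasurableSpace.comap (X k) inferInstance

/-- `X` is, under `μ`, a discrete-time, time-homogeneous Markov process with one-step transition
kernel `P`, started at the non-random point `x₀`. -/
structure IsMarkovProcess (P : Kernel S S) (x₀ : S) (X : ℕ → Ω → S) (μ : Measure Ω) : Prop where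
  measurable : ∀ n, Measurable (X n)
  initial : ∀ᵐ ω ∂μ, X 0 ω = x₀
  markov : ∀ (n : ℕ) (B : Set S), MeasurableSet B →
    μ⟦X (n + 1) ⁻¹' B | history X n⟧ =ᵐ[μ] fun ω => (P (X n ω)).real B

end Chain

section Assumptions

variable {d : ℕ} {S : Set (E d)}

/-- The mean increment `μ(x) = E_x[Δ]`, where `x + Δ` has law `P x`. -/
def drift (P : Kernel S S) (x : S) : E d :=
  ∫ y : S, ((y : E d) - (x : E d)) ∂(P x)

/-- The increment covariance matrix `M(x) = E_x[Δ Δᵀ]`. -/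
def covMatrix (P : Kernel S S) (x : S) : Matrix (Fin d) (Fin d) ℝ :=
  Matrix.of fun i j => ∫ y : S, ((y : E d) - (x : E d)) i * ((y : E d) - (x : E d)) j ∂(P x)

/-- Operator norm of a matrix with respect to the Euclidean norm. -/
def opNorm (A : Matrix (Fin d) (Fin d) ℝ) : ℝ :=
  ‖Matrix.toEuclideanCLM (n := Fin d) (𝕜 := ℝ) A‖

/-- The bilinear form `⟨y, z⟩_u = yᵀ σ²(u) z`. -/
def formAt (σ : Sph d → Matrix (Fin d) (Fin d) ℝ) (u : Sph d) (y z : E d) : ℝ :=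
  y.ofLp ⬝ᵥ (σ u *ᵥ z.ofLp)

/-- `ε(r)`, the supremum of `‖M(x) - σ²(x̂)‖_op` over the `x` in the state space with `‖x‖ ≥ r`,
valued in `[0, ∞]`. -/
def covError [NeZero d] (P : Kernel S S) (σ : Sph d → Matrix (Fin d) (Fin d) ℝ) (r : ℝ) : ℝ≥0∞ :=
  ⨆ x : S, ⨆ _ : r ≤ ‖(x : E d)‖, ENNReal.ofReal (opNorm (covMatrix P x - σ (hat (x : E d))))

/-- A0: the increments have uniformly bounded `p`-th moments for some `p > 2`. -/
def UniformMoments (P : Kernel S S) : Prop :=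
  ∃ p : ℝ, 2 < p ∧ ⨆ x : S, ∫⁻ y : S, ‖(y : E d) - (x : E d)‖ₑ ^ p ∂(P x) < ∞

/-- A1: zero drift. -/
def ZeroDrift (P : Kernel S S) : Prop :=
  ∀ x : S, drift P x = 0

/-- A2: uniform non-degeneracy. -/
def UniformNondegenerate (P : Kernel S S) : Prop :=
  ∃ v : ℝ, 0 < v ∧ ∀ x : S, v ≤ (covMatrix P x).trace

/-- A3: the increment covariance is asymptotically `σ²` along rays, uniformly, where `σ²` takes
(symmetric) positive-definite values. -/
def CovLimit [NeZero d] (P : Kernel S S) (σ : Sph d → Matrix (Fin d) (Fin d) ℝ) : Prop :=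
  (∀ u, (σ u).PosDef) ∧ Tendsto (covError P σ) atTop (𝓝 0)

/-- A4: constant radial variance `U` and constant total variance `V`, with `0 < U < V`. -/
def CovForm (σ : Sph d → Matrix (Fin d) (Fin d) ℝ) (U V : ℝ) : Prop :=
  0 < U ∧ U < V ∧ ∀ u : Sph d, formAt σ u (u : E d) (u : E d) = U ∧ (σ u).trace = V

/-- `ε(r) = O(r^{-δ₀})` as `r → ∞`, for some `δ₀ > 0`. -/
def PolynomialCovError [NeZero d] (P : Kernel S S)
    (σ : Sph d → Matrix (Fin d) (Fin d) ℝ) : Prop :=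
  ∃ δ₀ : ℝ, 0 < δ₀ ∧ ∃ C r₀ : ℝ, ∀ r : ℝ, r₀ ≤ r →
    covError P σ r ≤ ENNReal.ofReal (C * r ^ (-δ₀))

end Assumptions

open Classical in
/-- The fraction of the times `0, …, n-1` that the path `w` spends in `A`. -/
def occupationFraction {α : Type*} (w : ℕ → α) (A : Set α) (n : ℕ) : ℝ :=
  (1 / (n : ℝ)) * ∑ k ∈ Finset.range n, if w k ∈ A then (1 : ℝ) else 0

end NonhomWalk

end

/-!
A zero-drift walk whose increments have bounded `p`-th moments, `p > 2`, and a total variance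
bounded below spends only `O(√n)` of its first `n` steps, on average, in any given ball,
whether it is transient or recurrent.

Let `f x = √(1 + ‖x‖²)`, a convex function with linear growth. As the walk has zero drift, `f (X n)`
is a submartingale by Jensen's inequality. On a ball `f` is uniformly strictly convex at bounded
distances (`tangent_add_le_sqrt_one_add_norm_sq`), and the moment condition forbids the variance
from being carried by very large jumps, so that the mean of `f` increases by at least some `c > 0`
at every step from the ball (`exists_potential_increase`). Summing over time,
`c · E[visits to the ball before time n] ≤ E[f (X n)]`. Orthogonality of the increments gives
`E[‖X n‖²] = O(n)`, hence `E[f (X n)] = O(√n)`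
(`IsMarkovProcess.exists_lintegral_visits_le`).

The expected occupation fractions at the times `4 ^ k` are therefore `O(2 ^ (-k))`, which is
summable, and so these fractions tend to zero almost surely. Monotonicity of the visit counts
extends this to all times (`tendsto_occupationFraction_of_pow`), and since the fractions are at most
one, convergence in `L^q` follows by dominated convergence.
-/

namespace NonhomWalk

/-! ### The convex function `√(1 + ‖x‖²)` -/

lemma sqrt_one_add_norm_sq_add_le {F : Type*} [NormedAddCommGroup F] (x y : F) :
    √(1 + ‖y‖ ^ 2) ≤ √(1 + ‖x‖ ^ 2) + ‖y - x‖ := by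
  have hx : ‖x‖ ≤ √(1 + ‖x‖ ^ 2) := Real.le_sqrt_of_sq_le (by linarith)
  have ha : √(1 + ‖x‖ ^ 2) ^ 2 = 1 + ‖x‖ ^ 2 := Real.sq_sqrt (by positivity)
  have hy : ‖y‖ ≤ ‖x‖ + ‖y - x‖ := by
    simpa using norm_add_le x (y - x)
  apply Real.sqrt_le_iff.2 ⟨by positivity, ?_⟩
  nlinarith [norm_nonneg x, norm_nonneg y, norm_nonneg (y - x),
    mul_le_mul_of_nonneg_right hx (norm_nonneg (y - x))]

/-- A quantitative form of the strict convexity of `x ↦ √(1 + ‖x‖²)`: its graph lies above the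
tangent hyperplane at `x`. -/
lemma tangent_add_le_sqrt_one_add_norm_sq {F : Type*} [NormedAddCommGroup F]
    [InnerProductSpace ℝ F] (x y : F) :
    √(1 + ‖x‖ ^ 2) + (√(1 + ‖x‖ ^ 2))⁻¹ * inner ℝ x (y - x)
      + ‖y - x‖ ^ 2 / (2 * √(1 + ‖x‖ ^ 2) ^ 2 * (√(1 + ‖x‖ ^ 2) + ‖y - x‖))
      ≤ √(1 + ‖y‖ ^ 2) := by
  have hb := sqrt_one_add_norm_sq_add_le x y
  have ha2 : √(1 + ‖x‖ ^ 2) ^ 2 = 1 + ‖x‖ ^ 2 := Real.sq_sqrt (by positivity)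
  have hb2 : √(1 + ‖y‖ ^ 2) ^ 2 = 1 + ‖y‖ ^ 2 := Real.sq_sqrt (by positivity)
  have ha : 0 < √(1 + ‖x‖ ^ 2) := Real.sqrt_pos.2 (by positivity)
  have hb0 : 0 < √(1 + ‖y‖ ^ 2) := Real.sqrt_pos.2 (by positivity)
  set a := √(1 + ‖x‖ ^ 2)
  set b := √(1 + ‖y‖ ^ 2)
  have ht : ‖y - x‖ ^ 2 = ‖y‖ ^ 2 - 2 * inner ℝ x y + ‖x‖ ^ 2 := by
    rw [norm_sub_sq_real, real_inner_comm]
  have hi : inner ℝ x (y - x) = inner ℝ x y - ‖x‖ ^ 2 := by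
    rw [inner_sub_right, real_inner_self_eq_norm_sq]
  have hcs : (inner ℝ x y) ^ 2 ≤ ‖x‖ ^ 2 * ‖y‖ ^ 2 := by
    rw [← mul_pow, ← sq_abs]
    exact pow_le_pow_left₀ (abs_nonneg _) (abs_real_inner_le_norm x y) 2
  rw [hi]
  have ht0 := norm_nonneg (y - x)
  set t := ‖y - x‖
  set i : ℝ := inner ℝ x y
  -- Lagrange's identity for the vectors `(1, x)` and `(1, y)`, whose norms are `a` and `b`
  have hlag : t ^ 2 + (1 + i) ^ 2 ≤ (a * b) ^ 2 := by
    rw [mul_pow, ha2, hb2, ht]; nlinarith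
  have hab : 0 < a * b := mul_pos ha hb0
  have hle : 1 + i ≤ a * b := abs_le_of_sq_le_sq' (by nlinarith [sq_nonneg t]) hab.le |>.2
  have hkey : t ^ 2 ≤ (a * b - (1 + i)) * (2 * (a * (a + t))) := by
    calc t ^ 2 ≤ (a * b - (1 + i)) * (a * b + (1 + i)) := by nlinarith
      _ ≤ (a * b - (1 + i)) * (2 * (a * (a + t))) := by
        apply mul_le_mul_of_nonneg_left _ (by linarith)
        nlinarith [mul_le_mul_of_nonneg_left hb ha.le]
  have h1 : t ^ 2 / (2 * a ^ 2 * (a + t)) ≤ (a * b - (1 + i)) / a := by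
    rw [div_le_div_iff₀ (by positivity) ha]
    nlinarith [mul_le_mul_of_nonneg_right hkey ha.le]
  have h2 : a + a⁻¹ * (i - ‖x‖ ^ 2) + (a * b - (1 + i)) / a = b := by
    have : ‖x‖ ^ 2 = a ^ 2 - 1 := by linarith
    rw [this]; field_simp; ring
  linarith

/-- Truncation at level `K`: the term `K ^ (2 - p) * t ^ p` dominates `t ^ 2` when `K ≤ t`. -/
lemma sq_sub_rpow_le {p K a t : ℝ} (hp : 2 < p) (hK : 0 < K) (ha : 0 < a) (ht : 0 ≤ t) :
    (t ^ 2 - K ^ (2 - p) * t ^ p) / (a + K) ≤ t ^ 2 / (a + t) := by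
  have hpos : 0 ≤ K ^ (2 - p) * t ^ p := by positivity
  rcases le_total t K with h | h
  · calc _ ≤ t ^ 2 / (a + K) := by gcongr; linarith
      _ ≤ _ := by gcongr
  · have ht' : 0 < t := hK.trans_le h
    have h1 : t ^ 2 ≤ K ^ (2 - p) * t ^ p := by
      have h2 : t ^ (2 - p) ≤ K ^ (2 - p) :=
        Real.rpow_le_rpow_of_nonpos hK h (by linarith)
      calc t ^ 2 = t ^ (2 - p) * t ^ p := by
            rw [← Real.rpow_add ht', sub_add_cancel, Real.rpow_two]
        _ ≤ _ := by gcongr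
    calc _ ≤ (0 : ℝ) := div_nonpos_of_nonpos_of_nonneg (by linarith) (by positivity)
      _ ≤ _ := by positivity

/-! ### One-step estimates -/

section OneStep

variable {d : ℕ} {S : Set (E d)} {P : Kernel S S}

lemma measurable_increment (x : S) : Measurable fun y : S => (y : E d) - (x : E d) :=
  measurable_subtype_coe.sub_const _

/-- `UniformMoments` in terms of Bochner integrals. -/
lemma UniformMoments.exists_integral_le [IsMarkovKernel P] (h : UniformMoments P) :
    ∃ p C : ℝ, 2 < p ∧ 0 ≤ C ∧ ∀ x : S,
      MemLp (fun y : S => (y : E d) - (x : E d)) 2 (P x) ∧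
      Integrable (fun y : S => ‖(y : E d) - (x : E d)‖ ^ p) (P x) ∧
      ∫ y : S, ‖(y : E d) - (x : E d)‖ ^ p ∂(P x) ≤ C := by
  obtain ⟨p, hp, hfin⟩ := h
  have hp0 : 0 < p := by linarith
  refine ⟨p, (⨆ x : S, ∫⁻ y : S, ‖(y : E d) - (x : E d)‖ₑ ^ p ∂(P x)).toReal, hp,
    ENNReal.toReal_nonneg, fun x => ?_⟩
  have hx := le_iSup (fun x : S => ∫⁻ y : S, ‖(y : E d) - (x : E d)‖ₑ ^ p ∂(P x)) x
  have hmeas := (measurable_increment x).aestronglyMeasurable (μ := P x)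
  have hp' : (ENNReal.ofReal p).toReal = p := ENNReal.toReal_ofReal hp0.le
  have hmem : MemLp (fun y : S => (y : E d) - (x : E d)) (ENNReal.ofReal p) (P x) := by
    refine ⟨hmeas, ?_⟩
    rw [eLpNorm_lt_top_iff_lintegral_rpow_enorm_lt_top (by simpa using hp0) (by simp), hp']
    exact hx.trans_lt hfin
  have hint := hmem.integrable_norm_rpow (by simpa using hp0) (by simp)
  rw [hp'] at hint
  refine ⟨hmem.mono_exponent ?_, hint, ?_⟩
  · rw [← ENNReal.ofReal_ofNat]; exact ENNReal.ofReal_le_ofReal hp.le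
  · rw [integral_eq_lintegral_of_nonneg_ae (ae_of_all _ fun _ => by positivity)
      hint.aestronglyMeasurable]
    refine ENNReal.toReal_mono hfin.ne (le_trans (le_of_eq ?_) hx)
    refine lintegral_congr fun y => ?_
    rw [← ENNReal.ofReal_rpow_of_nonneg (norm_nonneg _) hp0.le, ofReal_norm]

lemma trace_covMatrix {x : S} (h : MemLp (fun y : S => (y : E d) - (x : E d)) 2 (P x)) :
    (covMatrix P x).trace = ∫ y : S, ‖(y : E d) - (x : E d)‖ ^ 2 ∂(P x) := by
  have hcoord : ∀ i, MemLp (fun y : S => ((y : E d) - (x : E d)) i) 2 (P x) := fun i =>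
    h.mono ((by fun_prop : Continuous fun z : E d => z i).measurable.comp
      (measurable_increment x)).aestronglyMeasurable
      (ae_of_all _ fun y => PiLp.norm_apply_le ((y : E d) - (x : E d)) i)
  simp only [EuclideanSpace.real_norm_sq_eq, Matrix.trace, Matrix.diag, covMatrix, Matrix.of_apply]
  rw [integral_finsetSum _ fun i _ => (hcoord i).integrable_sq]
  simp only [sq]

/-- With zero drift, linear functions of the increment have mean zero. -/
lemma ZeroDrift.integral_inner [IsMarkovKernel P] (h : ZeroDrift P) {x : S}
    (hx : MemLp (fun y : S => (y : E d) - (x : E d)) 2 (P x)) (z : E d) :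
    ∫ y : S, inner ℝ z ((y : E d) - (x : E d)) ∂(P x) = 0 := by
  rw [_root_.integral_inner (hx.integrable one_le_two)]
  have := h x
  rw [drift] at this
  rw [this, inner_zero_right]

/-- With zero drift the increment is orthogonal to the current position, so squared norms add up. -/
lemma lintegral_norm_sq_le [IsMarkovKernel P] {C : ℝ} (hdrift : ZeroDrift P) (x : S)
    (hx : MemLp (fun y : S => (y : E d) - (x : E d)) 2 (P x))
    (hC : ∫ y : S, ‖(y : E d) - (x : E d)‖ ^ 2 ∂(P x) ≤ C) :
    ∫⁻ y : S, ENNReal.ofReal (‖(y : E d)‖ ^ 2) ∂(P x)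
      ≤ ENNReal.ofReal (‖(x : E d)‖ ^ 2) + ENNReal.ofReal C := by
  have hinner : Integrable (fun y : S => inner ℝ (x : E d) ((y : E d) - (x : E d))) (P x) :=
    (hx.integrable one_le_two).const_inner _
  have hsq := hx.integrable_norm_pow two_ne_zero
  have heq : ∀ y : S, ‖(y : E d)‖ ^ 2 = ‖(x : E d)‖ ^ 2
      + 2 * inner ℝ (x : E d) ((y : E d) - (x : E d)) + ‖(y : E d) - (x : E d)‖ ^ 2 := by
    intro y
    rw [← norm_add_sq_real, add_sub_cancel]
  have hint1 : Integrable (fun y : S => ‖(x : E d)‖ ^ 2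
      + 2 * inner ℝ (x : E d) ((y : E d) - (x : E d))) (P x) :=
    (integrable_const _).add (hinner.const_mul 2)
  have hC0 : 0 ≤ C := le_trans (integral_nonneg fun _ => by positivity) hC
  rw [← ENNReal.ofReal_add (by positivity) hC0]
  rw [lintegral_congr fun y => congrArg ENNReal.ofReal (heq y),
    ← ofReal_integral_eq_lintegral_ofReal (by exact hint1.add hsq)
    (ae_of_all _ fun y => by
      dsimp only [Pi.zero_apply]; rw [← heq]; positivity)]
  refine ENNReal.ofReal_le_ofReal ?_
  rw [integral_add hint1 hsq, integral_add (integrable_const _) (hinner.const_mul 2),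
    integral_const_mul, hdrift.integral_inner hx]
  simpa using hC

/-- The mean of `√(1 + ‖·‖²)` never decreases in one step, and increases by at least `c` from
points of a bounded region. -/
lemma exists_potential_increase [IsMarkovKernel P] (h0 : UniformMoments P) (h1 : ZeroDrift P)
    (h2 : UniformNondegenerate P) (R : ℝ) :
    ∃ c : ℝ, 0 < c ∧ ∀ x : S,
      ENNReal.ofReal (√(1 + ‖(x : E d)‖ ^ 2))
        + ENNReal.ofReal c * (Subtype.val ⁻¹' Metric.closedBall (0 : E d) R : Set S).indicator 1 x
        ≤ ∫⁻ y : S, ENNReal.ofReal (√(1 + ‖(y : E d)‖ ^ 2)) ∂(P x) := by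
  obtain ⟨p, C, hp, hC0, hmom⟩ := h0.exists_integral_le
  obtain ⟨v, hv, hvx⟩ := h2
  -- a truncation level beyond which the increments carry at most half of the variance
  obtain ⟨K, hK0, hK⟩ : ∃ K : ℝ, 0 < K ∧ K ^ (2 - p) * C ≤ v / 2 := by
    have hlim : Tendsto (fun K : ℝ => K ^ (2 - p) * C) atTop (𝓝 0) := by
      have := (tendsto_rpow_neg_atTop (sub_pos.2 hp)).mul_const C
      simpa using this
    obtain ⟨K, hK0, hK⟩ := ((eventually_gt_atTop (0 : ℝ)).and
      (hlim.eventually_le_const (half_pos hv))).exists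
    exact ⟨K, hK0, hK⟩
  set A : ℝ := √(1 + R ^ 2)
  have hA : 0 < A := Real.sqrt_pos.2 (by positivity)
  refine ⟨v / 2 / (2 * A ^ 2 * (A + K)), by positivity, fun x => ?_⟩
  obtain ⟨hx, hxp, hxC⟩ := hmom x
  set a : ℝ := √(1 + ‖(x : E d)‖ ^ 2) with ha_def
  have ha : 0 < a := Real.sqrt_pos.2 (by positivity)
  have hsq := hx.integrable_norm_pow two_ne_zero
  have hinner : Integrable (fun y : S => inner ℝ (x : E d) ((y : E d) - (x : E d))) (P x) :=
    (hx.integrable one_le_two).const_inner _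
  have hlin : Integrable (fun y : S => a + a⁻¹ * inner ℝ (x : E d) ((y : E d) - (x : E d))) (P x) :=
    (integrable_const _).add (hinner.const_mul _)
  have hlin0 : ∫ y : S, (a + a⁻¹ * inner ℝ (x : E d) ((y : E d) - (x : E d))) ∂(P x) = a := by
    rw [integral_add (integrable_const _) (hinner.const_mul _), integral_const_mul,
      h1.integral_inner hx]
    simp
  have hf : Integrable (fun y : S => √(1 + ‖(y : E d)‖ ^ 2)) (P x) := by
    refine ((integrable_const a).add (hx.integrable one_le_two).norm).mono' ?_
      (ae_of_all _ fun y => ?_)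
    · exact (by fun_prop : Continuous fun y : S => √(1 + ‖(y : E d)‖ ^ 2)).aestronglyMeasurable
    · rw [Real.norm_of_nonneg (Real.sqrt_nonneg _)]
      exact sqrt_one_add_norm_sq_add_le (x : E d) (y : E d)
  rw [← ofReal_integral_eq_lintegral_ofReal hf (ae_of_all _ fun y => Real.sqrt_nonneg _)]
  by_cases hxR : x ∈ (Subtype.val ⁻¹' Metric.closedBall (0 : E d) R : Set S)
  · rw [Set.indicator_of_mem hxR, Pi.one_apply, mul_one,
      ← ENNReal.ofReal_add ha.le (by positivity)]
    refine ENNReal.ofReal_le_ofReal ?_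
    have hxR' : ‖(x : E d)‖ ≤ R := by simpa using hxR
    have haA : a ≤ A := Real.sqrt_le_sqrt (by gcongr)
    set D : ℝ := 2 * A ^ 2 * (A + K)
    have hD : 0 < D := by positivity
    have hG : Integrable (fun y : S => (‖(y : E d) - (x : E d)‖ ^ 2
        - K ^ (2 - p) * ‖(y : E d) - (x : E d)‖ ^ p) / D) (P x) :=
      (hsq.sub (hxp.const_mul _)).div_const _
    calc a + v / 2 / D
        ≤ ∫ y : S, (a + a⁻¹ * inner ℝ (x : E d) ((y : E d) - (x : E d))) ∂(P x)
          + ∫ y : S, (‖(y : E d) - (x : E d)‖ ^ 2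
            - K ^ (2 - p) * ‖(y : E d) - (x : E d)‖ ^ p) / D ∂(P x) := by
          rw [hlin0, integral_div, integral_sub hsq (hxp.const_mul _), integral_const_mul,
            ← trace_covMatrix hx]
          gcongr
          have := mul_le_mul_of_nonneg_left hxC (Real.rpow_nonneg hK0.le (2 - p))
          linarith [hvx x]
      _ = ∫ y : S, ((a + a⁻¹ * inner ℝ (x : E d) ((y : E d) - (x : E d)))
          + (‖(y : E d) - (x : E d)‖ ^ 2
            - K ^ (2 - p) * ‖(y : E d) - (x : E d)‖ ^ p) / D) ∂(P x) :=
          (integral_add hlin hG).symm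
      _ ≤ ∫ y : S, √(1 + ‖(y : E d)‖ ^ 2) ∂(P x) := by
          refine integral_mono (hlin.add hG) hf fun y => ?_
          refine le_trans ?_ (tangent_add_le_sqrt_one_add_norm_sq (x : E d) (y : E d))
          dsimp only
          rw [← ha_def]
          refine add_le_add_right ?_ _
          set t := ‖(y : E d) - (x : E d)‖
          have ht : 0 ≤ t := norm_nonneg _
          calc (t ^ 2 - K ^ (2 - p) * t ^ p) / D
              = (t ^ 2 - K ^ (2 - p) * t ^ p) / (A + K) / (2 * A ^ 2) := by
                rw [div_div, mul_comm (A + K)]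
            _ ≤ t ^ 2 / (A + t) / (2 * A ^ 2) := by
                exact div_le_div_of_nonneg_right (sq_sub_rpow_le hp hK0 hA ht) (by positivity)
            _ = t ^ 2 / (2 * A ^ 2 * (A + t)) := by rw [div_div, mul_comm (A + t)]
            _ ≤ t ^ 2 / (2 * a ^ 2 * (a + t)) := by gcongr
  · rw [Set.indicator_of_notMem hxR, mul_zero, add_zero]
    refine ENNReal.ofReal_le_ofReal ?_
    calc a = ∫ y : S, (a + a⁻¹ * inner ℝ (x : E d) ((y : E d) - (x : E d))) ∂(P x) := hlin0.symm
      _ ≤ _ := by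
        refine integral_mono hlin hf fun y => ?_
        refine le_trans ?_ (tangent_add_le_sqrt_one_add_norm_sq (x : E d) (y : E d))
        exact le_add_of_nonneg_right (by positivity)

end OneStep

/-! ### Expected occupation times -/

/-- The Chapman–Kolmogorov equation for the one-dimensional marginals. -/
lemma IsMarkovProcess.map_succ {S Ω : Type*} [MeasurableSpace S] [MeasurableSpace Ω]
    {P : Kernel S S} [IsMarkovKernel P] {x₀ : S} {X : ℕ → Ω → S} {μ : Measure Ω}
    [IsProbabilityMeasure μ] (hX : IsMarkovProcess P x₀ X μ) (n : ℕ) :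
    μ.map (X (n + 1)) = (μ.map (X n)).bind P := by
  ext B hB
  have hle : history X n ≤ ‹MeasurableSpace Ω› :=
    iSup₂_le fun k _ => (hX.measurable k).comap_le
  have hpre : MeasurableSet (X (n + 1) ⁻¹' B) := hX.measurable (n + 1) hB
  have h1 : μ.real (X (n + 1) ⁻¹' B) = ∫ ω, (P (X n ω)).real B ∂μ := by
    rw [← integral_congr_ae (hX.markov n B hB), integral_condExp hle]
    simp [integral_indicator, hpre]
  rw [Measure.map_apply (hX.measurable _) hB,
    Measure.bind_apply hB P.measurable.aemeasurable,
    lintegral_map (P.measurable_coe hB) (hX.measurable n),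
    ← ENNReal.ofReal_toReal (measure_ne_top μ (X (n + 1) ⁻¹' B))]
  change ENNReal.ofReal (μ.real _) = _
  have hm : Measurable fun ω => (P (X n ω)).real B :=
    ((P.measurable_coe hB).comp (hX.measurable n)).ennreal_toReal
  have hi : Integrable (fun ω => (P (X n ω)).real B) μ :=
    (integrable_const (1 : ℝ)).mono' hm.aestronglyMeasurable
      (ae_of_all _ fun ω => by
        rw [Real.norm_of_nonneg measureReal_nonneg]; exact measureReal_le_one)
  rw [h1, ofReal_integral_eq_lintegral_ofReal hi (ae_of_all _ fun _ => measureReal_nonneg)]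
  exact lintegral_congr fun ω => ENNReal.ofReal_toReal (measure_ne_top _ _)

lemma IsMarkovProcess.lintegral_succ {S Ω : Type*} [MeasurableSpace S] [MeasurableSpace Ω]
    {P : Kernel S S} [IsMarkovKernel P] {x₀ : S} {X : ℕ → Ω → S} {μ : Measure Ω}
    [IsProbabilityMeasure μ] (hX : IsMarkovProcess P x₀ X μ) (n : ℕ) {f : S → ℝ≥0∞}
    (hf : Measurable f) :
    ∫⁻ ω, f (X (n + 1) ω) ∂μ = ∫⁻ ω, ∫⁻ y, f y ∂(P (X n ω)) ∂μ := by
  rw [← lintegral_map hf (hX.measurable _), hX.map_succ,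
    Measure.lintegral_bind P.measurable.aemeasurable hf.aemeasurable,
    lintegral_map hf.lintegral_kernel (hX.measurable n)]

section Occupation

variable {d : ℕ} {S : Set (E d)} {P : Kernel S S} [IsMarkovKernel P]
  {Ω : Type*} [MeasurableSpace Ω] {μ : Measure Ω} [IsProbabilityMeasure μ]
  {x₀ : S} {X : ℕ → Ω → S}

/-- The walk is diffusive: its mean square grows at most linearly. -/
lemma IsMarkovProcess.exists_lintegral_norm_sq_le (hX : IsMarkovProcess P x₀ X μ)
    (h0 : UniformMoments P) (h1 : ZeroDrift P) :
    ∃ C : ℝ, 0 ≤ C ∧ ∀ n : ℕ, ∫⁻ ω, ENNReal.ofReal (‖(X n ω : E d)‖ ^ 2) ∂μ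
      ≤ ENNReal.ofReal (‖(x₀ : E d)‖ ^ 2 + n * C) := by
  obtain ⟨p, C, hp, hC0, hmom⟩ := h0.exists_integral_le
  refine ⟨1 + C, by positivity, fun n => ?_⟩
  have hmeas : Measurable fun y : S => ENNReal.ofReal (‖(y : E d)‖ ^ 2) := by fun_prop
  have hstep : ∀ x : S, ∫⁻ y : S, ENNReal.ofReal (‖(y : E d)‖ ^ 2) ∂(P x)
      ≤ ENNReal.ofReal (‖(x : E d)‖ ^ 2) + ENNReal.ofReal (1 + C) := by
    intro x
    obtain ⟨hx, hxp, hxC⟩ := hmom x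
    refine lintegral_norm_sq_le h1 x hx ?_
    calc ∫ y : S, ‖(y : E d) - (x : E d)‖ ^ 2 ∂(P x)
        ≤ ∫ y : S, (1 + ‖(y : E d) - (x : E d)‖ ^ p) ∂(P x) := by
          refine integral_mono (hx.integrable_norm_pow two_ne_zero)
            ((integrable_const _).add hxp) fun y => ?_
          dsimp only
          set t := ‖(y : E d) - (x : E d)‖
          have ht : 0 ≤ t := norm_nonneg _
          rcases le_total t 1 with h | h
          · have : 0 ≤ t ^ p := by positivity
            nlinarith
          · have := Real.rpow_le_rpow_of_exponent_le h hp.le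
            rw [Real.rpow_two] at this
            linarith
      _ ≤ 1 + C := by
          rw [integral_add (integrable_const _) hxp]
          simpa using hxC
  induction n with
  | zero =>
    have : ∫⁻ ω, ENNReal.ofReal (‖(X 0 ω : E d)‖ ^ 2) ∂μ
        = ∫⁻ _, ENNReal.ofReal (‖(x₀ : E d)‖ ^ 2) ∂μ :=
      lintegral_congr_ae (hX.initial.mono fun ω h => by simp only [h])
    rw [this]
    simp
  | succ n ih =>
    rw [hX.lintegral_succ n hmeas]
    calc _ ≤ ∫⁻ ω, (ENNReal.ofReal (‖(X n ω : E d)‖ ^ 2) + ENNReal.ofReal (1 + C)) ∂μ :=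
          lintegral_mono fun ω => hstep (X n ω)
      _ = ∫⁻ ω, ENNReal.ofReal (‖(X n ω : E d)‖ ^ 2) ∂μ + ENNReal.ofReal (1 + C) := by
          rw [lintegral_add_right _ measurable_const]; simp
      _ ≤ ENNReal.ofReal (‖(x₀ : E d)‖ ^ 2 + n * (1 + C)) + ENNReal.ofReal (1 + C) := by gcongr
      _ = _ := by
          rw [← ENNReal.ofReal_add (by positivity) (by positivity)]
          push_cast; ring_nf

/-- The expected number of visits to a ball before time `n` is `O(√n)`; the bound is stated along
the powers of four. -/
lemma IsMarkovProcess.exists_lintegral_visits_le (hX : IsMarkovProcess P x₀ X μ)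
    (h0 : UniformMoments P) (h1 : ZeroDrift P) (h2 : UniformNondegenerate P) (R : ℝ) :
    ∃ K : ℝ≥0∞, K ≠ ∞ ∧ ∀ k : ℕ,
      ∑ j ∈ Finset.range (4 ^ k),
        ∫⁻ ω, (Subtype.val ⁻¹' Metric.closedBall (0 : E d) R : Set S).indicator 1 (X j ω) ∂μ
        ≤ K * 2 ^ k := by
  obtain ⟨c, hc, hstep⟩ := exists_potential_increase h0 h1 h2 R
  obtain ⟨C, hC0, hsq⟩ := hX.exists_lintegral_norm_sq_le h0 h1
  set B : Set S := Subtype.val ⁻¹' Metric.closedBall (0 : E d) R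
  have hB : MeasurableSet B := measurable_subtype_coe Metric.isClosed_closedBall.measurableSet
  have hind : Measurable (B.indicator (1 : S → ℝ≥0∞)) := measurable_one.indicator hB
  have hf : Measurable fun y : S => ENNReal.ofReal (√(1 + ‖(y : E d)‖ ^ 2)) := by fun_prop
  have hsum : ∀ n : ℕ, ENNReal.ofReal c *
      ∑ j ∈ Finset.range n, ∫⁻ ω, B.indicator 1 (X j ω) ∂μ
      ≤ ∫⁻ ω, ENNReal.ofReal (√(1 + ‖(X n ω : E d)‖ ^ 2)) ∂μ := by
    intro n
    induction n with
    | zero => simp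
    | succ n ih =>
      rw [hX.lintegral_succ n hf, Finset.sum_range_succ, mul_add]
      calc _ ≤ ∫⁻ ω, ENNReal.ofReal (√(1 + ‖(X n ω : E d)‖ ^ 2)) ∂μ
            + ENNReal.ofReal c * ∫⁻ ω, B.indicator 1 (X n ω) ∂μ := by gcongr
        _ = ∫⁻ ω, (ENNReal.ofReal (√(1 + ‖(X n ω : E d)‖ ^ 2))
            + ENNReal.ofReal c * B.indicator 1 (X n ω)) ∂μ := by
          rw [lintegral_add_left (f := fun ω => ENNReal.ofReal (√(1 + ‖(X n ω : E d)‖ ^ 2)))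
              (hf.comp (hX.measurable n)),
            lintegral_const_mul (f := fun ω => B.indicator 1 (X n ω)) _
              (hind.comp (hX.measurable n))]
        _ ≤ _ := lintegral_mono fun ω => hstep (X n ω)
  refine ⟨(ENNReal.ofReal c)⁻¹ * ENNReal.ofReal (‖(x₀ : E d)‖ ^ 2 + C + 2),
    ENNReal.mul_ne_top (by simpa using hc) ENNReal.ofReal_ne_top, fun k => ?_⟩
  have hc' : ENNReal.ofReal c ≠ 0 := by simpa using hc
  rw [mul_assoc, ← ENNReal.div_eq_inv_mul,
    ENNReal.le_div_iff_mul_le (.inl hc') (.inl ENNReal.ofReal_ne_top), mul_comm]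
  refine (hsum _).trans ?_
  -- weighted arithmetic–geometric mean inequality, balanced at `‖X n‖ ≈ √n = 2 ^ k`
  have hamgm : ∀ z : E d, √(1 + ‖z‖ ^ 2) ≤ (2 ^ k : ℝ)⁻¹ * ‖z‖ ^ 2 + 2 * 2 ^ k := by
    intro z
    have h2k : (1 : ℝ) ≤ 2 ^ k := one_le_pow₀ one_le_two
    set s : ℝ := 2 ^ k
    have hz := norm_nonneg z
    refine (Real.sqrt_le_iff.2 ⟨by positivity, by nlinarith⟩ :
      √(1 + ‖z‖ ^ 2) ≤ 1 + ‖z‖).trans ?_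
    have : ‖z‖ ≤ s⁻¹ * ‖z‖ ^ 2 + s := by
      rw [inv_mul_eq_div, ← sub_le_iff_le_add, le_div_iff₀ (by positivity)]
      nlinarith [sq_nonneg (‖z‖ - s)]
    linarith
  have hm2 : Measurable fun y : S => ENNReal.ofReal (‖(y : E d)‖ ^ 2) := by fun_prop
  calc ∫⁻ ω, ENNReal.ofReal (√(1 + ‖(X (4 ^ k) ω : E d)‖ ^ 2)) ∂μ
      ≤ ∫⁻ ω, (ENNReal.ofReal ((2 ^ k : ℝ)⁻¹) * ENNReal.ofReal (‖(X (4 ^ k) ω : E d)‖ ^ 2)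
          + ENNReal.ofReal (2 * 2 ^ k)) ∂μ := by
        refine lintegral_mono fun ω => ?_
        rw [← ENNReal.ofReal_mul (by positivity), ← ENNReal.ofReal_add (by positivity)
          (by positivity)]
        exact ENNReal.ofReal_le_ofReal (hamgm _)
    _ = ENNReal.ofReal ((2 ^ k : ℝ)⁻¹) * ∫⁻ ω, ENNReal.ofReal (‖(X (4 ^ k) ω : E d)‖ ^ 2) ∂μ
          + ENNReal.ofReal (2 * 2 ^ k) := by
        rw [lintegral_add_right _ measurable_const,
          lintegral_const_mul (f := fun ω => ENNReal.ofReal (‖(X (4 ^ k) ω : E d)‖ ^ 2)) _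
            (hm2.comp (hX.measurable _))]
        simp
    _ ≤ ENNReal.ofReal ((2 ^ k : ℝ)⁻¹) * ENNReal.ofReal (‖(x₀ : E d)‖ ^ 2 + (4 ^ k : ℕ) * C)
          + ENNReal.ofReal (2 * 2 ^ k) := by gcongr; exact hsq _
    _ ≤ ENNReal.ofReal ((‖(x₀ : E d)‖ ^ 2 + C + 2) * 2 ^ k) := by
        rw [← ENNReal.ofReal_mul (by positivity), ← ENNReal.ofReal_add (by positivity)
          (by positivity)]
        refine ENNReal.ofReal_le_ofReal ?_
        have h2k : (1 : ℝ) ≤ 2 ^ k := one_le_pow₀ one_le_two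
        have h4 : ((4 ^ k : ℕ) : ℝ) = 2 ^ k * 2 ^ k := by
          push_cast; rw [← mul_pow]; norm_num
        rw [h4]
        set s : ℝ := 2 ^ k
        have hinv : s⁻¹ ≤ s := (inv_le_one_of_one_le₀ h2k).trans h2k
        have : s⁻¹ * (‖(x₀ : E d)‖ ^ 2 + s * s * C) = s⁻¹ * ‖(x₀ : E d)‖ ^ 2 + s * C := by
          field_simp
        rw [this]
        nlinarith [mul_le_mul_of_nonneg_right hinv (sq_nonneg ‖(x₀ : E d)‖)]
    _ = _ := by
        rw [ENNReal.ofReal_mul (by positivity), ENNReal.ofReal_pow zero_le_two,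
          ENNReal.ofReal_ofNat]

end Occupation

/-! ### Occupation fractions -/

section Fraction

variable {α : Type*}

lemma occupationFraction_nonneg (w : ℕ → α) (A : Set α) (n : ℕ) :
    0 ≤ occupationFraction w A n := by
  classical
  exact mul_nonneg (by positivity) (Finset.sum_nonneg fun k _ => by split_ifs <;> norm_num)

lemma occupationFraction_mono (w : ℕ → α) {A B : Set α} (h : A ⊆ B) (n : ℕ) :
    occupationFraction w A n ≤ occupationFraction w B n := by
  classical
  unfold occupationFraction
  gcongr with k
  split_ifs with h1 h2 h2
  · exact le_rfl
  · exact absurd (h h1) h2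
  · exact zero_le_one
  · exact le_rfl

lemma occupationFraction_le_one (w : ℕ → α) (A : Set α) (n : ℕ) :
    occupationFraction w A n ≤ 1 := by
  classical
  unfold occupationFraction
  rw [one_div, inv_mul_eq_div]
  refine div_le_one_of_le₀ ?_ (Nat.cast_nonneg n)
  calc _ ≤ ∑ k ∈ Finset.range n, (1 : ℝ) := by
        gcongr with k
        split_ifs <;> norm_num
    _ = n := by simp

lemma ofReal_occupationFraction (w : ℕ → α) (A : Set α) {n : ℕ} (hn : n ≠ 0) :
    ENNReal.ofReal (occupationFraction w A n)
      = (n : ℝ≥0∞)⁻¹ * ∑ k ∈ Finset.range n, A.indicator 1 (w k) := by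
  classical
  unfold occupationFraction
  rw [ENNReal.ofReal_mul (by positivity), one_div, ENNReal.ofReal_inv_of_pos (by positivity),
    ENNReal.ofReal_natCast, ENNReal.ofReal_sum_of_nonneg
      (fun k _ => by split_ifs <;> norm_num)]
  congr 1
  refine Finset.sum_congr rfl fun k _ => ?_
  by_cases h : w k ∈ A <;> simp [h]

/-- Since visit counts are monotone in time, convergence along the powers of four suffices. -/
lemma tendsto_occupationFraction_of_pow (w : ℕ → α) (A : Set α)
    (h : Tendsto (fun k : ℕ => occupationFraction w A (4 ^ k)) atTop (𝓝 0)) :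
    Tendsto (occupationFraction w A) atTop (𝓝 0) := by
  classical
  have hlog : Tendsto (fun n : ℕ => Nat.log 4 n + 1) atTop atTop :=
    (tendsto_add_atTop_nat 1).comp
      (tendsto_atTop_atTop.2 fun b => ⟨4 ^ b, fun n hn => Nat.le_log_of_pow_le (by norm_num) hn⟩)
  have h4 := (h.comp hlog).const_mul 4
  rw [mul_zero] at h4
  refine squeeze_zero' (Eventually.of_forall fun n => occupationFraction_nonneg w A n) ?_ h4
  filter_upwards [eventually_ne_atTop 0] with n hn
  have hle : 4 ^ Nat.log 4 n ≤ n := Nat.pow_log_le_self 4 hn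
  have hlt : n < 4 ^ (Nat.log 4 n + 1) := Nat.lt_pow_succ_log_self (by norm_num) n
  have hn' : (0 : ℝ) < n := by positivity
  simp only [Function.comp_apply, occupationFraction]
  set m := 4 ^ (Nat.log 4 n + 1) with hm
  have hmn : (m : ℝ) ≤ 4 * n := by
    have : m ≤ 4 * n := by rw [hm, pow_succ]; omega
    exact_mod_cast this
  have hm0 : (0 : ℝ) < m := by positivity
  rw [← mul_assoc]
  refine mul_le_mul ?_ ?_ (Finset.sum_nonneg fun k _ => by split_ifs <;> norm_num) (by positivity)
  · rw [mul_one_div, div_le_div_iff₀ hn' hm0]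
    linarith
  · exact Finset.sum_le_sum_of_subset_of_nonneg (Finset.range_mono hlt.le)
      fun k _ _ => by split_ifs <;> norm_num

end Fraction

/-- A zero-drift walk with uniformly non-degenerate increments spends asymptotically a zero
fraction of its time in any ball. -/
lemma IsMarkovProcess.ae_tendsto_occupationFraction {d : ℕ} {S : Set (E d)} {P : Kernel S S}
    [IsMarkovKernel P] {Ω : Type*} [MeasurableSpace Ω] {μ : Measure Ω} [IsProbabilityMeasure μ]
    {x₀ : S} {X : ℕ → Ω → S} (hX : IsMarkovProcess P x₀ X μ)
    (h0 : UniformMoments P) (h1 : ZeroDrift P) (h2 : UniformNondegenerate P) (R : ℝ) :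
    ∀ᵐ ω ∂μ, Tendsto
      (fun n : ℕ => occupationFraction (fun k => (X k ω : E d)) (Metric.closedBall 0 R) n)
      atTop (𝓝 0) := by
  obtain ⟨K, hK, hvis⟩ := hX.exists_lintegral_visits_le h0 h1 h2 R
  set B : Set S := Subtype.val ⁻¹' Metric.closedBall (0 : E d) R
  have hB : MeasurableSet B := measurable_subtype_coe Metric.isClosed_closedBall.measurableSet
  have hind : ∀ j, Measurable fun ω => B.indicator (1 : S → ℝ≥0∞) (X j ω) := fun j =>
    (measurable_one.indicator hB).comp (hX.measurable j)
  have heq : ∀ (k : ℕ) (ω : Ω),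
      ENNReal.ofReal (occupationFraction (fun k => (X k ω : E d)) (Metric.closedBall 0 R) (4 ^ k))
        = ((4 ^ k : ℕ) : ℝ≥0∞)⁻¹ * ∑ j ∈ Finset.range (4 ^ k), B.indicator 1 (X j ω) :=
    fun k ω => ofReal_occupationFraction _ _ (by positivity)
  have hmeas : ∀ k : ℕ, Measurable fun ω =>
      ENNReal.ofReal
        (occupationFraction (fun k => (X k ω : E d)) (Metric.closedBall 0 R) (4 ^ k)) := by
    intro k
    simp only [heq]
    exact (Finset.measurable_sum _ fun j _ => hind j).const_mul _
  have hmean : ∀ k : ℕ, ∫⁻ ω, ENNReal.ofReal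
      (occupationFraction (fun k => (X k ω : E d)) (Metric.closedBall 0 R) (4 ^ k)) ∂μ
      ≤ K * 2⁻¹ ^ k := by
    intro k
    simp only [heq]
    rw [lintegral_const_mul _ (Finset.measurable_sum _ fun j _ => hind j),
      lintegral_finsetSum _ fun j _ => hind j]
    calc _ ≤ ((4 ^ k : ℕ) : ℝ≥0∞)⁻¹ * (K * 2 ^ k) := by gcongr; exact hvis k
      _ = K * (((4 ^ k : ℕ) : ℝ≥0∞)⁻¹ * 2 ^ k) := by ring
      _ = K * 2⁻¹ ^ k := by
        congr 1
        have : ((4 ^ k : ℕ) : ℝ≥0∞) = 2 ^ k * 2 ^ k := by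
          push_cast; rw [← mul_pow]; norm_num
        rw [this, ENNReal.mul_inv (by simp) (by simp), mul_assoc,
          ENNReal.inv_mul_cancel (by simp) (by simp), mul_one, ENNReal.inv_pow]
  have hfin : ∫⁻ ω, ∑' k : ℕ, ENNReal.ofReal
      (occupationFraction (fun k => (X k ω : E d)) (Metric.closedBall 0 R) (4 ^ k)) ∂μ ≠ ∞ := by
    rw [lintegral_tsum fun k => (hmeas k).aemeasurable]
    refine ne_top_of_le_ne_top ?_ (ENNReal.tsum_le_tsum hmean)
    rw [ENNReal.tsum_mul_left, ENNReal.tsum_geometric]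
    exact ENNReal.mul_ne_top hK (by simp [ENNReal.one_sub_inv_two])
  filter_upwards [ae_lt_top (Measurable.tsum hmeas) hfin] with ω hω
  refine tendsto_occupationFraction_of_pow _ _ ?_
  have := (ENNReal.tendsto_toReal ENNReal.zero_ne_top).comp
    (ENNReal.tendsto_atTop_zero_of_tsum_ne_top hω.ne)
  refine this.congr fun k => ?_
  exact ENNReal.toReal_ofReal (occupationFraction_nonneg _ _ _)

lemma measurable_occupationFraction {α Ω : Type*} [MeasurableSpace α] [MeasurableSpace Ω]
    {X : ℕ → Ω → α} (hX : ∀ n, Measurable (X n)) {B : Set α} (hB : MeasurableSet B) (n : ℕ) :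
    Measurable fun ω => occupationFraction (fun k => X k ω) B n := by
  classical
  unfold occupationFraction
  refine (Finset.measurable_sum _ fun k _ => ?_).const_mul _
  exact Measurable.ite (hX k hB) measurable_const measurable_const

/-- Bounded almost sure convergence to zero is convergence to zero in every `L^q`, `q < ∞`. -/
lemma tendsto_eLpNorm_zero_of_ae_of_le_one {Ω : Type*} [MeasurableSpace Ω] {μ : Measure Ω}
    [IsFiniteMeasure μ] {f : ℕ → Ω → ℝ} (hf : ∀ n, Measurable (f n))
    (hle : ∀ n ω, ‖f n ω‖ ≤ 1) (hlim : ∀ᵐ ω ∂μ, Tendsto (fun n => f n ω) atTop (𝓝 0))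
    {q : ℝ≥0∞} (hq : 1 ≤ q) (hq' : q ≠ ∞) :
    Tendsto (fun n => eLpNorm (f n) q μ) atTop (𝓝 0) := by
  have hq0 : q ≠ 0 := (zero_lt_one.trans_le hq).ne'
  have hqr : 0 < q.toReal := ENNReal.toReal_pos hq0 hq'
  have hint : Tendsto (fun n => ∫⁻ ω, ‖f n ω‖ₑ ^ q.toReal ∂μ) atTop (𝓝 (∫⁻ _, 0 ∂μ)) := by
    refine tendsto_lintegral_of_dominated_convergence (fun _ => 1)
      (fun n => (hf n).enorm.pow_const _) (fun n => ae_of_all _ fun ω => ?_) (by simp) ?_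
    · refine ENNReal.rpow_le_one ?_ hqr.le
      rw [← ofReal_norm]
      exact ENNReal.ofReal_le_one.2 (hle n ω)
    · filter_upwards [hlim] with ω hω
      have := (hω.enorm).ennrpow_const q.toReal
      simpa [hqr] using this
  have := hint.ennrpow_const (1 / q.toReal)
  rw [lintegral_zero, ENNReal.zero_rpow_of_pos (by positivity)] at this
  exact this.congr fun n => (eLpNorm_eq_lintegral_rpow_enorm_toReal hq0 hq').symm

end NonhomWalk

theorem mainTheorem2 {d : ℕ} [NeZero d] (S : Set (NonhomWalk.E d))
    (hS : MeasurableSet S) (hS_unbdd : ¬ Bornology.IsBounded S)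
    (P : Kernel S S) [IsMarkovKernel P]
    {Ω : Type*} [MeasurableSpace Ω] (μ : Measure Ω) [IsProbabilityMeasure μ]
    (x₀ : S) (X : ℕ → Ω → S) (hX : NonhomWalk.IsMarkovProcess P x₀ X μ)
    (hA0 : NonhomWalk.UniformMoments P)
    (hA1 : NonhomWalk.ZeroDrift P)
    (hA2 : NonhomWalk.UniformNondegenerate P)
    (σ : NonhomWalk.Sph d → Matrix (Fin d) (Fin d) ℝ)
    (hA3 : NonhomWalk.CovLimit P σ)
    (U V : ℝ) (hA4 : NonhomWalk.CovForm σ U V)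
    (hcase : 2 * U < V ∨ 2 * U > V ∨ (2 * U = V ∧ NonhomWalk.PolynomialCovError P σ))
    (A : Set (NonhomWalk.E d)) (hA : Bornology.IsBounded A) :
    (∀ᵐ ω ∂μ, Tendsto
      (fun n : ℕ => NonhomWalk.occupationFraction (fun k => (X k ω : NonhomWalk.E d)) A n)
      atTop (𝓝 0)) ∧
    ∀ q : ℝ≥0∞, 1 ≤ q → q ≠ ∞ →
      Tendsto
        (fun n : ℕ => eLpNorm
          (fun ω => NonhomWalk.occupationFraction (fun k => (X k ω : NonhomWalk.E d)) A n) q μ)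
        atTop (𝓝 0) := by
  obtain ⟨R, hR⟩ := hA.subset_closedBall 0
  have hball := hX.ae_tendsto_occupationFraction hA0 hA1 hA2 R
  constructor
  · filter_upwards [hball] with ω hω
    exact squeeze_zero (fun n => NonhomWalk.occupationFraction_nonneg _ _ n)
      (fun n => NonhomWalk.occupationFraction_mono _ hR n) hω
  · intro q hq hq'
    -- `A` need not be measurable, so dominated convergence is applied to the ball
    refine tendsto_of_tendsto_of_tendsto_of_le_of_le tendsto_const_nhds
      (NonhomWalk.tendsto_eLpNorm_zero_of_ae_of_le_one (fun n =>
        NonhomWalk.measurable_occupationFraction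
          (fun k => measurable_subtype_coe.comp (hX.measurable k))
          Metric.isClosed_closedBall.measurableSet n) (fun n ω => ?_) hball hq hq')
      (fun n => zero_le) (fun n => eLpNorm_mono_real fun ω => ?_)
    · rw [Real.norm_of_nonneg (NonhomWalk.occupationFraction_nonneg _ _ n)]
      exact NonhomWalk.occupationFraction_le_one _ _ n
    · rw [Real.norm_of_nonneg (NonhomWalk.occupationFraction_nonneg _ _ n)]
      exact NonhomWalk.occupationFraction_mono _ hR n
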